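/- Let $n\ge 0$ and let $A$ be a complex $n\times n$ matrix with spectrum $\sigma(A)$. A complex $n\times n$ matrix $V$ is called a partial isometry if the restriction of $V$ to $(\ker V)^{\perp}$ is isometric for the Euclidean norm on $\mathbb{C}^n$, i.e. $\|Vx\|=\|x\|$ for all $x\in(\ker V)^{\perp}$. Then $A$ is similar to a partial isometry if and only if the following three conditions hold: (a) $|\lambda|\le 1$ for every $\lambda\in\sigma(A)$; (b) if $\zeta\in\sigma(A)$ and $|\zeta|=1$, then the algebraic and geometric multiplicities of $\zeta$ as an eigenvalue of $A$ are equal; (c) $\operatorname{nullity}(A)\ge\operatorname{nullity}(A-\lambda I)$ for every $\lambda\in\sigma(A)$ with $|\lambda|<1$. -/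

import Mathlib

namespace Matrix

/-- A complex `n × n` matrix `V`, acting on `ℂⁿ` with its Euclidean inner product, is a partial
isometry if its restriction to the orthogonal complement of its kernel is isometric. -/
def IsPartialIsometry {n : ℕ} (V : Matrix (Fin n) (Fin n) ℂ) : Prop :=
  ∀ x ∈ (LinearMap.ker (Matrix.toEuclideanLin V))ᗮ, ‖Matrix.toEuclideanLin V x‖ = ‖x‖

/-- The nullity of a matrix is the dimension of its kernel. -/
noncomputable def nullity {n : ℕ} (A : Matrix (Fin n) (Fin n) ℂ) : ℕ :=
  Module.finrank ℂ (LinearMap.ker (Matrix.toLin' A))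

/-- The algebraic multiplicity of `μ` is its multiplicity as a root of the characteristic
polynomial. -/
noncomputable def algebraicMultiplicity {n : ℕ} (A : Matrix (Fin n) (Fin n) ℂ) (μ : ℂ) : ℕ :=
  A.charpoly.rootMultiplicity μ

/-- The geometric multiplicity of `μ` is the dimension of its eigenspace. -/
noncomputable def geometricMultiplicity {n : ℕ} (A : Matrix (Fin n) (Fin n) ℂ) (μ : ℂ) : ℕ :=
  Module.finrank ℂ (Module.End.eigenspace (Matrix.toLin' A) μ)

end Matrix

open Module

/-! Necessity: a partial isometry is a contraction, so its eigenvalues lie in the closed disk and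
its powers are bounded, which excludes Jordan chains for unimodular eigenvalues. For `‖μ‖ < 1`, no
nonzero eigenvector is orthogonal to the kernel, so projection onto the kernel is injective on the
eigenspace.

Sufficiency: let `F` be Euclidean with `dim F = dim ker f`. Choose `C : E → F` injective on every
eigenspace inside the disk and zero on the unimodular part, and `π` recording the unimodular part
with an `f`-invariant norm. In the norm given by `‖π x‖² + ∑ ‖C (f ^ k x)‖²`, shifting the series
shows that the defect of `f` is `‖C x‖²`. The form is definite because its null space is invariant
and contains no eigenvector. By `isometry_ker_orthogonal_of_defect`, the equality of dimensions
makes `f` a partial isometry for this norm. -/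

/-- A family of linear maps on the summands of an internal direct sum glues to a linear map. -/
theorem DirectSum.IsInternal.exists_linearMap_extends {R M N ι : Type*} [Ring R] [AddCommGroup M]
    [Module R M] [AddCommGroup N] [Module R N] [DecidableEq ι] {p : ι → Submodule R M}
    (hp : DirectSum.IsInternal p) (g : ι → M →ₗ[R] N) :
    ∃ G : M →ₗ[R] N, ∀ i, ∀ x ∈ p i, G x = g i x := by
  let e := LinearEquiv.ofBijective (DirectSum.coeLinearMap p) hp
  refine ⟨(DirectSum.toModule R ι N fun i => g i ∘ₗ (p i).subtype) ∘ₗ e.symm.toLinearMap, ?_⟩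
  intro i x hx
  have he : e.symm x = DirectSum.lof R ι (fun i => p i) i ⟨x, hx⟩ := by
    rw [LinearEquiv.symm_apply_eq]
    exact (DirectSum.coeLinearMap_of p i ⟨x, hx⟩).symm
  simp [he]

/-- A linear map that is injective on a subspace exists into every space of sufficient dimension. -/
theorem LinearMap.exists_disjoint_ker_of_finrank_le {K V W : Type*} [Field K] [AddCommGroup V]
    [Module K V] [AddCommGroup W] [Module K W] [FiniteDimensional K W] [FiniteDimensional K V]
    (p : Submodule K V) (h : finrank K p ≤ finrank K W) :
    ∃ g : V →ₗ[K] W, ∀ x ∈ p, g x = 0 → x = 0 := by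
  obtain ⟨i, hi⟩ := finrank_le_iff_exists_linearMap.1 h
  obtain ⟨g, hg⟩ := LinearMap.exists_extend i
  refine ⟨g, fun x hx hgx => ?_⟩
  have h1 : i ⟨x, hx⟩ = 0 := by rw [← hg]; simpa using hgx
  simpa using (map_eq_zero_iff i hi).1 h1

/-! ### Orbits of generalized eigenvectors -/

/-- A sequence obeying a contracting scalar recursion with summable forcing is summable in norm. -/
theorem summable_norm_of_succ_eq_smul_add {F : Type*} [NormedAddCommGroup F] [NormedSpace ℂ F]
    {μ : ℂ} (hμ : ‖μ‖ < 1) {a y : ℕ → F} (hy : Summable fun k => ‖y k‖)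
    (h : ∀ k, a (k + 1) = μ • a k + y k) : Summable fun k => ‖a k‖ := by
  -- Summing the recursion bounds a partial sum `s` by `‖a 0‖ + ‖μ‖ s + ∑ ‖y k‖`; solving for `s`
  -- gives the constant.
  refine summable_of_sum_range_le (c := (‖a 0‖ + ∑' k, ‖y k‖) / (1 - ‖μ‖))
    (fun _ => norm_nonneg _) fun N => ?_
  rw [le_div_iff₀ (by linarith)]
  have h1 : ∑ k ∈ Finset.range N, ‖a (k + 1)‖
      ≤ ‖μ‖ * ∑ k ∈ Finset.range N, ‖a k‖ + ∑' k, ‖y k‖ := by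
    calc ∑ k ∈ Finset.range N, ‖a (k + 1)‖
        ≤ ∑ k ∈ Finset.range N, (‖μ‖ * ‖a k‖ + ‖y k‖) := by
          refine Finset.sum_le_sum fun k _ => ?_
          rw [h, ← norm_smul]
          exact norm_add_le _ _
      _ ≤ _ := by
          rw [Finset.sum_add_distrib, ← Finset.mul_sum]
          gcongr
          exact hy.sum_le_tsum _ fun _ _ => norm_nonneg _
  have h2 := Finset.sum_range_succ (fun k => ‖a k‖) N
  rw [Finset.sum_range_succ'] at h2
  nlinarith [norm_nonneg (a N)]

/-- The orbit of a generalized eigenvector for an eigenvalue in the open unit disk is summable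
after applying a linear map. -/
theorem Module.End.summable_norm_of_mem_maxGenEigenspace {E F : Type*} [AddCommGroup E]
    [Module ℂ E] [NormedAddCommGroup F] [NormedSpace ℂ F] (f : End ℂ E) (C : E →ₗ[ℂ] F) {μ : ℂ}
    (hμ : ‖μ‖ < 1) {x : E} (hx : x ∈ f.maxGenEigenspace μ) :
    Summable fun k : ℕ => ‖C ((f ^ k) x)‖ := by
  obtain ⟨k, hk⟩ := (f.mem_maxGenEigenspace μ x).1 hx
  clear hx
  induction k generalizing x with
  | zero =>
    obtain rfl : x = 0 := by simpa using hk
    simp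
  | succ k ih =>
    rw [pow_succ, Module.End.mul_apply] at hk
    -- The forcing term is the orbit of `(f - μ) x`, which a lower power of `f - μ` kills.
    refine summable_norm_of_succ_eq_smul_add hμ (ih hk) fun j => ?_
    simp only [LinearMap.sub_apply, LinearMap.smul_apply, Module.End.one_apply, map_sub, map_smul,
      pow_succ, Module.End.mul_apply]
    abel

/-- If the second power of `f - ζ` has no larger kernel than `f - ζ`, then neither have the higher
powers. -/
theorem Module.End.maxGenEigenspace_le_eigenspace {K V : Type*} [Field K] [AddCommGroup V]
    [Module K V] (f : End K V) (ζ : K)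
    (h : ∀ x, (f - ζ • 1) ((f - ζ • 1) x) = 0 → (f - ζ • 1) x = 0) :
    f.maxGenEigenspace ζ ≤ f.eigenspace ζ := by
  intro x hx
  obtain ⟨k, hk⟩ := (f.mem_maxGenEigenspace ζ x).1 hx
  clear hx
  induction k generalizing x with
  | zero =>
    obtain rfl : x = 0 := by simpa using hk
    exact zero_mem _
  | succ k ih =>
    rw [pow_succ, Module.End.mul_apply] at hk
    have h1 := ih hk
    rw [Module.End.mem_eigenspace_iff] at h1 ⊢
    have h2 := h x (by simpa [sub_eq_zero] using h1)
    simpa [sub_eq_zero] using h2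

/-- A unimodular eigenvalue of a contraction has no generalized eigenvectors of rank two. -/
theorem Module.End.sub_smul_apply_eq_zero_of_contraction {E : Type*} [NormedAddCommGroup E]
    [NormedSpace ℂ E] (g : End ℂ E) (hg : ∀ x, ‖g x‖ ≤ ‖x‖) {ζ : ℂ} (hζ : ‖ζ‖ = 1) (x : E)
    (h : (g - ζ • 1) ((g - ζ • 1) x) = 0) : (g - ζ • 1) x = 0 := by
  set y := (g - ζ • 1) x with hy
  have hgx : g x = ζ • x + y := by simp [hy]
  have hgy : g y = ζ • y := by simpa [sub_eq_zero] using h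
  -- The extra factor `ζ` avoids the exponent `k - 1` in `g ^ k x = ζ ^ k x + k ζ ^ (k - 1) y`.
  have hpow : ∀ k : ℕ, ζ • (g ^ k) x = ζ ^ k • (ζ • x + (k : ℂ) • y) := by
    intro k
    induction k with
    | zero => simp
    | succ k ih =>
      rw [pow_succ', Module.End.mul_apply, ← map_smul, ih]
      simp only [map_smul, map_add, hgx, hgy]
      push_cast
      module
  have hle : ∀ k : ℕ, ‖(g ^ k) x‖ ≤ ‖x‖ := by
    intro k
    induction k with
    | zero => simp
    | succ k ih =>
      rw [pow_succ', Module.End.mul_apply]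
      exact (hg _).trans ih
  have hbd : ∀ k : ℕ, (k : ℝ) * ‖y‖ ≤ 2 * ‖x‖ := by
    intro k
    have h1 : ‖ζ • x + (k : ℂ) • y‖ ≤ ‖x‖ := by
      have := congrArg norm (hpow k)
      simp only [norm_smul, norm_pow, hζ, one_pow, one_mul] at this
      exact this ▸ hle k
    have h2 : ‖(k : ℂ) • y‖ = k * ‖y‖ := by simp [norm_smul]
    have h3 : ‖ζ • x‖ = ‖x‖ := by simp [norm_smul, hζ]
    have h4 := norm_sub_le (ζ • x + (k : ℂ) • y) (ζ • x)
    rw [add_sub_cancel_left, h2, h3] at h4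
    linarith
  by_contra hne
  have hpos : 0 < ‖y‖ := norm_pos_iff.2 hne
  obtain ⟨k, hk⟩ := exists_nat_gt (2 * ‖x‖ / ‖y‖)
  rw [div_lt_iff₀ hpos] at hk
  exact absurd (hbd k) (not_le.2 hk)

/-! ### Partial isometries and their defect -/

section InnerProduct

variable {E : Type*} [NormedAddCommGroup E] [InnerProductSpace ℂ E] [FiniteDimensional ℂ E]

theorem Module.End.norm_apply_le_of_isometry_ker_orthogonal (g : End ℂ E)
    (hg : ∀ x ∈ (LinearMap.ker g)ᗮ, ‖g x‖ = ‖x‖) (x : E) : ‖g x‖ ≤ ‖x‖ := by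
  obtain ⟨y, hy, z, hz, rfl⟩ := (LinearMap.ker g).exists_add_mem_mem_orthogonal x
  rw [map_add, LinearMap.mem_ker.1 hy, zero_add, hg z hz]
  have h := norm_add_sq_eq_norm_sq_add_norm_sq_of_inner_eq_zero y z
    ((Submodule.mem_orthogonal _ _).1 hz y hy)
  nlinarith [norm_nonneg (y + z), norm_nonneg z, mul_self_nonneg ‖y‖]

/-- An eigenvector `x` orthogonal to the kernel would satisfy `‖μ‖ ‖x‖ = ‖x‖`, so projection onto
the kernel is injective on the eigenspace. -/
theorem Module.End.finrank_eigenspace_le_finrank_ker_of_isometry_ker_orthogonal (g : End ℂ E)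
    (hg : ∀ x ∈ (LinearMap.ker g)ᗮ, ‖g x‖ = ‖x‖) {μ : ℂ} (hμ : ‖μ‖ < 1) :
    finrank ℂ (g.eigenspace μ) ≤ finrank ℂ (LinearMap.ker g) := by
  refine LinearMap.finrank_le_finrank_of_injective
    (f := (LinearMap.ker g).orthogonalProjectionOnto.toLinearMap ∘ₗ (g.eigenspace μ).subtype) ?_
  rw [← LinearMap.ker_eq_bot, LinearMap.ker_eq_bot']
  rintro ⟨x, hx⟩ h
  have h1 : x ∈ (LinearMap.ker g)ᗮ := by
    simpa using h
  have h2 := hg x h1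
  rw [Module.End.mem_eigenspace_iff.1 hx, norm_smul] at h2
  have h3 : ‖x‖ = 0 := by nlinarith [norm_nonneg x]
  simpa using h3

/-- If the defect `‖x‖² - ‖g x‖²` is the squared norm of a linear map of rank at most the nullity of
`g`, then `g` is isometric on the orthogonal complement of its kernel. -/
theorem Module.End.isometry_ker_orthogonal_of_defect {F : Type*} [NormedAddCommGroup F]
    [NormedSpace ℂ F] [FiniteDimensional ℂ F] (g : End ℂ E) (C : E →ₗ[ℂ] F)
    (hC : ∀ x, ‖x‖ ^ 2 = ‖g x‖ ^ 2 + ‖C x‖ ^ 2)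
    (hF : finrank ℂ (LinearMap.ker g) = finrank ℂ F) :
    ∀ x ∈ (LinearMap.ker g)ᗮ, ‖g x‖ = ‖x‖ := by
  intro x hx
  have hinj : Function.Injective (C ∘ₗ (LinearMap.ker g).subtype) := by
    rw [← LinearMap.ker_eq_bot, LinearMap.ker_eq_bot']
    rintro ⟨z, hz⟩ h
    have h1 := hC z
    have h2 : C z = 0 := h
    rw [LinearMap.mem_ker.1 hz, h2] at h1
    simpa using h1
  obtain ⟨⟨y, hy⟩, hyx⟩ :=
    (LinearMap.injective_iff_surjective_of_finrank_eq_finrank hF).1 hinj (C x)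
  have hyx' : C y = C x := hyx
  -- Since `C (x - y) = 0` and `g y = 0`, this reads `‖x - y‖ = ‖g x‖ ≤ ‖x‖`, while Pythagoras gives
  -- `‖x - y‖ ≥ ‖x‖`.
  have h1 := hC (x - y)
  rw [map_sub, map_sub, hyx', sub_self, LinearMap.mem_ker.1 hy, sub_zero, norm_zero] at h1
  have h2 := norm_add_sq_eq_norm_sq_add_norm_sq_of_inner_eq_zero (𝕜 := ℂ) x (-y) (by
    rw [inner_neg_right, (Submodule.mem_orthogonal' _ _).1 hx y hy, neg_zero])
  rw [← sub_eq_add_neg, norm_neg] at h2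
  have h3 := hC x
  have h4 : ‖g x‖ ^ 2 = ‖x‖ ^ 2 := by nlinarith [mul_self_nonneg ‖y‖, sq_nonneg ‖C x‖]
  exact (sq_eq_sq₀ (norm_nonneg _) (norm_nonneg _)).1 h4

end InnerProduct

/-! ### The new norm and its definiteness -/

/-- If every orbit is square summable after applying `C`, the norm on the range of the observability
map `x ↦ (π x, (C (f ^ k x))ₖ)` measures the defect of `f` by `C`. -/
theorem Module.End.exists_observability_map {E P F : Type*} [AddCommGroup E] [Module ℂ E]
    [NormedAddCommGroup P] [InnerProductSpace ℂ P] [NormedAddCommGroup F] [InnerProductSpace ℂ F]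
    (f : End ℂ E) (π : E →ₗ[ℂ] P) (hπ : ∀ x, ‖π (f x)‖ = ‖π x‖) (C : E →ₗ[ℂ] F)
    (hC : ∀ x, Summable fun k : ℕ => ‖C ((f ^ k) x)‖) :
    ∃ T : E →ₗ[ℂ] WithLp 2 (P × lp (fun _ : ℕ => F) 2),
      (∀ x, ‖T x‖ ^ 2 = ‖T (f x)‖ ^ 2 + ‖C x‖ ^ 2) ∧
      ∀ x, T x = 0 → π x = 0 ∧ ∀ k : ℕ, C ((f ^ k) x) = 0 := by
  have hmem : ∀ x, Memℓp (fun k : ℕ => C ((f ^ k) x)) 2 := fun x =>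
    (Memℓp.of_exponent_ge (q := 1) ((memℓp_gen_iff (by simp)).2 (by simpa using hC x))
      (by norm_num))
  let L : E →ₗ[ℂ] lp (fun _ : ℕ => F) 2 :=
    { toFun := fun x => ⟨fun k => C ((f ^ k) x), hmem x⟩
      map_add' := fun x y => by
        ext k
        exact (congrArg C (map_add (f ^ k) x y)).trans (map_add C _ _)
      map_smul' := fun c x => by ext k; simp }
  have hL : ∀ x k, L x k = C ((f ^ k) x) := fun _ _ => rfl
  have hsum : ∀ x, HasSum (fun k : ℕ => ‖C ((f ^ k) x)‖ ^ 2) (‖L x‖ ^ 2) := fun x => by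
    simpa [hL] using lp.hasSum_norm (p := 2) (by norm_num) (L x)
  have hshift : ∀ x, ‖L x‖ ^ 2 = ‖L (f x)‖ ^ 2 + ‖C x‖ ^ 2 := fun x => by
    have h1 := hsum (f x)
    simp only [← Module.End.mul_apply, ← pow_succ] at h1
    have h2 := (hasSum_nat_add_iff (f := fun k : ℕ => ‖C ((f ^ k) x)‖ ^ 2) 1).1 h1
    simpa using (hsum x).unique h2
  refine ⟨(WithLp.linearEquiv 2 ℂ _).symm.toLinearMap ∘ₗ (π.prod L), fun x => ?_, fun x hx => ?_⟩
  · simp only [WithLp.prod_norm_sq_eq_of_L2]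
    simp [hπ, hshift x, add_assoc]
  · have h : π x = 0 ∧ L x = 0 := by simpa using hx
    exact ⟨h.1, fun k => by rw [← hL, h.2]; rfl⟩

/-- A linear map whose kernel is invariant under `f` and contains no eigenvector of `f` is
injective. -/
theorem Module.End.injective_of_ker_invariant {K V W : Type*} [Field K] [IsAlgClosed K]
    [AddCommGroup V] [Module K V] [FiniteDimensional K V] [AddCommGroup W] [Module K W]
    (f : End K V) (T : V →ₗ[K] W) (hT : ∀ x, T x = 0 → T (f x) = 0)
    (h : ∀ (μ : K) x, f x = μ • x → T x = 0 → x = 0) : Function.Injective T := by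
  rw [← LinearMap.ker_eq_bot]
  by_contra hne
  have : Nontrivial (LinearMap.ker T) := Submodule.nontrivial_iff_ne_bot.2 hne
  obtain ⟨μ, hμ⟩ := Module.End.exists_eigenvalue (f.restrict (p := LinearMap.ker T) hT)
  obtain ⟨⟨x, hx⟩, hv⟩ := hμ.exists_hasEigenvector
  refine hv.2 (Subtype.ext (h μ x ?_ hx))
  exact congrArg Subtype.val hv.apply_eq_smul

/-- An injective linear map into an inner product space is, up to a linear isometry on its range, a
linear equivalence with a Euclidean space. -/
theorem LinearMap.exists_equiv_euclideanSpace_norm_eq {E H : Type*} [AddCommGroup E] [Module ℂ E]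
    [FiniteDimensional ℂ E] [NormedAddCommGroup H] [InnerProductSpace ℂ H] (T : E →ₗ[ℂ] H)
    (hT : Function.Injective T) {n : ℕ} (hn : finrank ℂ E = n) :
    ∃ S : E ≃ₗ[ℂ] EuclideanSpace ℂ (Fin n), ∀ x, ‖S x‖ = ‖T x‖ := by
  let e := LinearEquiv.ofInjective T hT
  have hr : finrank ℂ (LinearMap.range T) = n := by rw [← hn, e.finrank_eq]
  let b := (stdOrthonormalBasis ℂ (LinearMap.range T)).reindex (finCongr hr)
  exact ⟨e.trans b.repr.toLinearEquiv, fun x => b.repr.norm_map (e x)⟩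

theorem LinearEquiv.finrank_eigenspace_conj {K V W : Type*} [Field K] [AddCommGroup V] [Module K V]
    [AddCommGroup W] [Module K W] (S : V ≃ₗ[K] W) (f : End K V) (μ : K) :
    finrank K ((S.conj f).eigenspace μ) = finrank K (f.eigenspace μ) := by
  refine (LinearEquiv.finrank_eq (S.ofSubmodules _ _ ?_)).symm
  ext x
  obtain ⟨y, rfl⟩ := S.surjective x
  simp [LinearEquiv.conj_apply, ← map_smul S, -_root_.map_smul]

theorem LinearEquiv.finrank_ker_conj {K V W : Type*} [Field K] [AddCommGroup V] [Module K V]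
    [AddCommGroup W] [Module K W] (S : V ≃ₗ[K] W) (f : End K V) :
    finrank K (LinearMap.ker (S.conj f)) = finrank K (LinearMap.ker f) := by
  rw [← Module.End.eigenspace_zero, ← Module.End.eigenspace_zero, S.finrank_eigenspace_conj]

/-! ### Choosing `π` and `C` from the spectral decomposition -/

section Spectral

variable {E : Type*} [AddCommGroup E] [Module ℂ E] [FiniteDimensional ℂ E] (f : End ℂ E)

theorem Module.End.isInternal_maxGenEigenspace [DecidableEq ℂ] :
    DirectSum.IsInternal f.maxGenEigenspace :=
  DirectSum.isInternal_submodule_of_iSupIndep_of_iSup_eq_top f.independent_maxGenEigenspace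
    f.iSup_maxGenEigenspace_eq_top

theorem Module.End.induction_maxGenEigenspace {p : E → Prop}
    (hmem : ∀ μ, ∀ x ∈ f.maxGenEigenspace μ, p x) (hadd : ∀ x y, p x → p y → p (x + y)) (x : E) :
    p x := by
  refine Submodule.iSup_induction (motive := p) f.maxGenEigenspace
    (by rw [f.iSup_maxGenEigenspace_eq_top]; trivial) hmem (hmem 0 0 (zero_mem _)) hadd

/-- If the unimodular eigenvalues are semisimple, the unimodular part of the spectrum is recorded by
a linear map whose norm is invariant under `f`. -/
theorem Module.End.exists_norm_invariant_map
    (hss : ∀ ζ, ‖ζ‖ = 1 → f.maxGenEigenspace ζ ≤ f.eigenspace ζ) :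
    ∃ π : E →ₗ[ℂ] PiLp 2 (fun _ : f.Eigenvalues => EuclideanSpace ℂ (Fin (finrank ℂ E))),
      (∀ x, ‖π (f x)‖ = ‖π x‖) ∧ ∀ (ζ : ℂ) x, ‖ζ‖ = 1 → f x = ζ • x → π x = 0 → x = 0 := by
  classical
  let j : E ≃ₗ[ℂ] EuclideanSpace ℂ (Fin (finrank ℂ E)) :=
    LinearEquiv.ofFinrankEq _ _ (by simp)
  -- For unimodular `ζ`, `Q ζ` is the spectral projection at `ζ` followed by `j`, which only
  -- supplies a norm; otherwise it is zero.
  choose Q hQ using fun ζ : ℂ => f.isInternal_maxGenEigenspace.exists_linearMap_extends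
    (fun μ => if μ = ζ ∧ ‖ζ‖ = 1 then j.toLinearMap else 0)
  have hcomm : ∀ ζ x, Q ζ (f x) = ζ • Q ζ x := by
    intro ζ
    refine f.induction_maxGenEigenspace (fun μ x hx => ?_) fun x y hx hy => by simp [hx, hy]
    rw [hQ ζ μ x hx, hQ ζ μ (f x)
      (Module.End.mapsTo_maxGenEigenspace_of_comm (Commute.refl f) μ hx)]
    split_ifs with h
    · obtain ⟨rfl, h1⟩ := h
      simp [Module.End.mem_eigenspace_iff.1 (hss μ h1 hx)]
    · simp
  have hzero : ∀ ζ, ‖ζ‖ ≠ 1 → ∀ x, Q ζ x = 0 := by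
    intro ζ hζ
    refine f.induction_maxGenEigenspace (fun μ x hx => ?_) fun x y hx hy => by simp [hx, hy]
    simp [hQ ζ μ x hx, hζ]
  have hnorm : ∀ ζ x, ‖Q ζ (f x)‖ = ‖Q ζ x‖ := by
    intro ζ x
    by_cases h : ‖ζ‖ = 1
    · simp [hcomm, norm_smul, h]
    · simp [hzero ζ h]
  refine ⟨(WithLp.linearEquiv 2 ℂ _).symm.toLinearMap ∘ₗ LinearMap.pi fun μ : f.Eigenvalues => Q μ,
    fun x => ?_, fun ζ x hζ hx h0 => ?_⟩
  · rw [← sq_eq_sq₀ (norm_nonneg _) (norm_nonneg _), PiLp.norm_sq_eq_of_L2,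
      PiLp.norm_sq_eq_of_L2]
    simp [hnorm]
  · by_contra hne
    have hev : f.HasEigenvalue ζ := Module.End.hasEigenvalue_of_hasEigenvector
      ⟨Module.End.mem_eigenspace_iff.2 hx, hne⟩
    have h1 : Q ζ x = 0 := congrArg (fun v => v.ofLp (⟨ζ, hev⟩ : f.Eigenvalues)) h0
    rw [hQ ζ ζ x (Module.End.eigenspace_le_maxGenEigenspace (Module.End.mem_eigenspace_iff.2 hx))] at h1
    simp [hζ] at h1
    exact hne h1

/-- If the eigenspaces for eigenvalues in the open unit disk have dimension at most `dim F`, some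
linear map to `F` is injective on each of them and has summable orbits under `f`. -/
theorem Module.End.exists_summable_observation {F : Type*} [NormedAddCommGroup F]
    [InnerProductSpace ℂ F] [FiniteDimensional ℂ F]
    (hF : ∀ μ, ‖μ‖ < 1 → finrank ℂ (f.eigenspace μ) ≤ finrank ℂ F) :
    ∃ C : E →ₗ[ℂ] F, (∀ x, Summable fun k : ℕ => ‖C ((f ^ k) x)‖) ∧
      ∀ (μ : ℂ) x, ‖μ‖ < 1 → f x = μ • x → C x = 0 → x = 0 := by
  classical
  have hg : ∀ μ : ℂ, ∃ g : E →ₗ[ℂ] F, (‖μ‖ < 1 → ∀ x ∈ f.eigenspace μ, g x = 0 → x = 0) ∧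
      (¬ ‖μ‖ < 1 → g = 0) := by
    intro μ
    by_cases hμ : ‖μ‖ < 1
    · obtain ⟨g, hg⟩ := LinearMap.exists_disjoint_ker_of_finrank_le _ (hF μ hμ)
      exact ⟨g, fun _ => hg, fun h => absurd hμ h⟩
    · exact ⟨0, fun h => absurd h hμ, fun _ => rfl⟩
  choose g hg hg0 using hg
  obtain ⟨C, hC⟩ := f.isInternal_maxGenEigenspace.exists_linearMap_extends g
  refine ⟨C, ?_, fun μ x hμ hx h0 => ?_⟩
  · refine f.induction_maxGenEigenspace (fun μ x hx => ?_) fun x y hx hy => ?_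
    · by_cases hμ : ‖μ‖ < 1
      · exact f.summable_norm_of_mem_maxGenEigenspace C hμ hx
      · have h0 : ∀ k : ℕ, C ((f ^ k) x) = 0 := fun k => by
          rw [hC μ _ (Module.End.mapsTo_maxGenEigenspace_of_comm (Commute.pow_right rfl k) μ hx),
            hg0 μ hμ, LinearMap.zero_apply]
        simp [h0]
    · refine Summable.of_nonneg_of_le (fun _ => norm_nonneg _) (fun k => ?_) (hx.add hy)
      rw [map_add, map_add]
      exact norm_add_le _ _
  · have hmem := Module.End.mem_eigenspace_iff.2 hx
    rw [hC μ x (Module.End.eigenspace_le_maxGenEigenspace hmem)] at h0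
    exact hg μ hμ x hmem h0

/-- The spectral conditions suffice for `f` to be isometric on the orthogonal complement of its
kernel with respect to some Euclidean structure. -/
theorem Module.End.exists_conj_isometry_ker_orthogonal {n : ℕ} (hn : finrank ℂ E = n)
    (hle : ∀ μ, f.HasEigenvalue μ → ‖μ‖ ≤ 1)
    (hss : ∀ ζ, ‖ζ‖ = 1 → f.maxGenEigenspace ζ ≤ f.eigenspace ζ)
    (hker : ∀ μ, ‖μ‖ < 1 → finrank ℂ (f.eigenspace μ) ≤ finrank ℂ (LinearMap.ker f)) :
    ∃ S : E ≃ₗ[ℂ] EuclideanSpace ℂ (Fin n),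
      ∀ x ∈ (LinearMap.ker (S.conj f))ᗮ, ‖S.conj f x‖ = ‖x‖ := by
  obtain ⟨π, hπ, hπ0⟩ := f.exists_norm_invariant_map hss
  obtain ⟨C, hC, hC0⟩ := f.exists_summable_observation
    (F := EuclideanSpace ℂ (Fin (finrank ℂ (LinearMap.ker f)))) (by simpa using hker)
  obtain ⟨T, hT, hT0⟩ := f.exists_observability_map π hπ C hC
  have hinj : Function.Injective T := by
    refine f.injective_of_ker_invariant T (fun x hx => ?_) fun μ x hμ hx => ?_
    · have h := hT x
      rw [hx, norm_zero] at h
      have h1 : ‖T (f x)‖ ^ 2 = 0 := by nlinarith [sq_nonneg ‖T (f x)‖, sq_nonneg ‖C x‖]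
      simpa using h1
    · by_contra hne
      have hev : f.HasEigenvalue μ := Module.End.hasEigenvalue_of_hasEigenvector
        ⟨Module.End.mem_eigenspace_iff.2 hμ, hne⟩
      obtain ⟨h1, h2⟩ := hT0 x hx
      rcases (hle μ hev).lt_or_eq with h | h
      · exact hne (hC0 μ x h hμ (by simpa using h2 0))
      · exact hne (hπ0 μ x h hμ h1)
  obtain ⟨S, hS⟩ := T.exists_equiv_euclideanSpace_norm_eq hinj hn
  refine ⟨S, (S.conj f).isometry_ker_orthogonal_of_defect (C ∘ₗ S.symm.toLinearMap)
    (fun x => ?_) ?_⟩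
  · obtain ⟨x, rfl⟩ := S.surjective x
    simp [LinearEquiv.conj_apply, hS, hT x]
  · rw [finrank_euclideanSpace_fin]
    exact S.finrank_ker_conj f

end Spectral

/-! ### Matrices and the final equivalence -/

theorem Module.End.isConj_iff_exists_conj {R M : Type*} [CommRing R] [AddCommGroup M] [Module R M]
    {f g : End R M} : IsConj f g ↔ ∃ e : M ≃ₗ[R] M, e.conj f = g := by
  constructor
  · rintro ⟨c, hc⟩
    refine ⟨LinearMap.GeneralLinearGroup.toLinearEquiv c, ?_⟩
    ext x
    obtain ⟨y, rfl⟩ := (LinearMap.GeneralLinearGroup.toLinearEquiv c).surjective x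
    rw [LinearEquiv.conj_apply_apply, LinearEquiv.symm_apply_apply]
    exact LinearMap.congr_fun hc.eq y
  · rintro ⟨e, rfl⟩
    refine ⟨LinearMap.GeneralLinearGroup.ofLinearEquiv e, ?_⟩
    ext x
    simp [LinearEquiv.conj_apply]

/-- A matrix is similar to one with a given property of its action on Euclidean space iff its action
is carried to one with that property by some linear equivalence. -/
theorem Matrix.exists_isConj_iff_exists_conj {n : ℕ} (A : Matrix (Fin n) (Fin n) ℂ)
    (p : End ℂ (EuclideanSpace ℂ (Fin n)) → Prop) :
    (∃ V, p (Matrix.toEuclideanLin V) ∧ IsConj A V) ↔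
      ∃ S : (Fin n → ℂ) ≃ₗ[ℂ] EuclideanSpace ℂ (Fin n), p (S.conj (Matrix.toLin' A)) := by
  let w := (WithLp.linearEquiv 2 ℂ (Fin n → ℂ)).symm
  have hw : ∀ V : Matrix (Fin n) (Fin n) ℂ, Matrix.toEuclideanLin V = w.conj (Matrix.toLin' V) :=
    fun _ => rfl
  constructor
  · rintro ⟨V, hV, hc⟩
    obtain ⟨e, he⟩ := Module.End.isConj_iff_exists_conj.1
      ((Matrix.toLinAlgEquiv' (R := ℂ) (n := Fin n)).toMonoidHom.map_isConj hc)
    have he' : e.conj (Matrix.toLin' A) = Matrix.toLin' V := he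
    refine ⟨e.trans w, ?_⟩
    rwa [hw, ← he', ← LinearEquiv.trans_apply, LinearEquiv.conj_trans] at hV
  · rintro ⟨S, hS⟩
    let e := S.trans w.symm
    refine ⟨LinearMap.toMatrix' (e.conj (Matrix.toLin' A)), ?_, ?_⟩
    · rwa [hw, Matrix.toLin'_toMatrix', ← LinearEquiv.trans_apply, LinearEquiv.conj_trans,
        LinearEquiv.trans_assoc, LinearEquiv.symm_trans_self, LinearEquiv.trans_refl]
    · have h := (LinearMap.toMatrixAlgEquiv' (R := ℂ) (n := Fin n)).toMonoidHom.map_isConj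
        (Module.End.isConj_iff_exists_conj.2 ⟨e, rfl⟩ : IsConj (Matrix.toLin' A) _)
      have hA : LinearMap.toMatrix' (Matrix.toLin' A) = A := LinearMap.toMatrix'_toLin' A
      exact (congrArg (IsConj · _) hA).mp h

theorem Matrix.nullity_sub_smul_one {n : ℕ} (A : Matrix (Fin n) (Fin n) ℂ) (μ : ℂ) :
    (A - μ • (1 : Matrix (Fin n) (Fin n) ℂ)).nullity =
      finrank ℂ (End.eigenspace (Matrix.toLin' A) μ) := by
  rw [Matrix.nullity, map_sub, map_smul, Matrix.toLin'_one, Module.End.eigenspace_def]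
  rfl

theorem Matrix.algebraicMultiplicity_eq_finrank {n : ℕ} (A : Matrix (Fin n) (Fin n) ℂ) (μ : ℂ) :
    A.algebraicMultiplicity μ = finrank ℂ (End.maxGenEigenspace (Matrix.toLin' A) μ) := by
  rw [LinearMap.finrank_maxGenEigenspace_eq, Matrix.charpoly_toLin', Matrix.algebraicMultiplicity]

theorem theorem1 (n : ℕ) (A : Matrix (Fin n) (Fin n) ℂ) :
    (∃ V : Matrix (Fin n) (Fin n) ℂ, V.IsPartialIsometry ∧ IsConj A V) ↔
      spectrum ℂ A ⊆ Metric.closedBall (0 : ℂ) 1 ∧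
      (∀ ζ ∈ spectrum ℂ A ∩ Metric.sphere (0 : ℂ) 1,
        A.algebraicMultiplicity ζ = A.geometricMultiplicity ζ) ∧
      (∀ μ ∈ spectrum ℂ A ∩ Metric.ball (0 : ℂ) 1,
        (A - μ • (1 : Matrix (Fin n) (Fin n) ℂ)).nullity ≤ A.nullity) := by
  refine (A.exists_isConj_iff_exists_conj
    (fun g => ∀ x ∈ (LinearMap.ker g)ᗮ, ‖g x‖ = ‖x‖)).trans ?_
  simp only [A.nullity_sub_smul_one, A.algebraicMultiplicity_eq_finrank,
    Matrix.geometricMultiplicity, ← Matrix.spectrum_toLin' A]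
  rw [Matrix.nullity]
  set f : End ℂ (Fin n → ℂ) := Matrix.toLin' A
  constructor
  · rintro ⟨S, hS⟩
    have hcontr := (S.conj f).norm_apply_le_of_isometry_ker_orthogonal hS
    have hconj : ∀ x, S.conj f (S x) = S (f x) := fun x => by simp [LinearEquiv.conj_apply]
    refine ⟨fun μ hμ => ?_, fun ζ hζ => ?_, fun μ hμ => ?_⟩
    · obtain ⟨x, hx⟩ := (Module.End.hasEigenvalue_iff_mem_spectrum.2 hμ).exists_hasEigenvector
      have h := hcontr (S x)
      rw [hconj, hx.apply_eq_smul, map_smul, norm_smul] at h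
      have hpos : 0 < ‖S x‖ := norm_pos_iff.2 (by simpa using hx.2)
      simpa using le_of_mul_le_mul_right (h.trans_eq (one_mul _).symm) hpos
    · suffices h : f.maxGenEigenspace ζ = f.eigenspace ζ by rw [h]
      refine le_antisymm (f.maxGenEigenspace_le_eigenspace ζ fun x hx => ?_)
        Module.End.eigenspace_le_maxGenEigenspace
      have hsub : ∀ y, S ((f - ζ • 1) y) = (S.conj f - ζ • 1) (S y) := fun y => by
        simp [LinearEquiv.conj_apply]
      apply S.map_eq_zero_iff.1
      rw [hsub]
      refine (S.conj f).sub_smul_apply_eq_zero_of_contraction hcontr (by simpa using hζ.2) _ ?_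
      rw [← hsub, ← hsub, hx, map_zero]
    · rw [← S.finrank_eigenspace_conj, ← S.finrank_ker_conj f]
      exact (S.conj f).finrank_eigenspace_le_finrank_ker_of_isometry_ker_orthogonal hS
        (by simpa using hμ.2)
  · rintro ⟨ha, hb, hc⟩
    refine f.exists_conj_isometry_ker_orthogonal (by simp) (fun μ hμ => ?_) (fun ζ hζ => ?_)
      fun μ hμ => ?_
    · simpa using ha (Module.End.hasEigenvalue_iff_mem_spectrum.1 hμ)
    · by_cases hs : f.HasEigenvalue ζ
      · exact (Submodule.eq_of_le_of_finrank_eq (Module.End.eigenspace_le_maxGenEigenspace)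
          (hb ζ ⟨Module.End.hasEigenvalue_iff_mem_spectrum.1 hs, by simpa using hζ⟩).symm).ge
      -- Off the spectrum `hb` is silent, but the eigenspace is trivial.
      · refine f.maxGenEigenspace_le_eigenspace ζ fun x hx => ?_
        have hbot : f.eigenspace ζ = ⊥ := by simpa [Module.End.hasEigenvalue_iff] using hs
        have hmem : (f - ζ • 1) x ∈ f.eigenspace ζ := by
          rw [Module.End.mem_eigenspace_iff]
          simpa [sub_eq_zero] using hx
        simpa [hbot] using hmem
    · by_cases hs : f.HasEigenvalue μ
      · exact hc μ ⟨Module.End.hasEigenvalue_iff_mem_spectrum.1 hs, by simpa using hμ⟩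
      · have hbot : f.eigenspace μ = ⊥ := by simpa [Module.End.hasEigenvalue_iff] using hs
        rw [hbot, finrank_bot]
        exact Nat.zero_le _
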